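/- Let $\mathcal H$ be a separable real Hilbert space. Let $A\colon\mathcal H\rightrightarrows\mathcal H$ be maximally monotone, and let $B\colon\mathcal H\to\mathcal H$ be monotone with $B=\frac1n\sum_{i=1}^n B_i$, where $n\ge 1$ and each $B_i\colon\mathcal H\to\mathcal H$ is $L$-Lipschitz continuous. Suppose that $(A+B)^{-1}(0)=\{x : 0\in A(x)+B(x)\}\neq\varnothing$ and that $\lambda\in\left(0,\frac1{2L}\right)$ (that is, $\lambda>0$ is arbitrary if $L=0$). Let $i_0,i_1,\dots$ be independent random variables, each uniformly distributed on $\{1,\dots,n\}$. Given $x_0,x_{-1}\in\mathcal H$, define $$x_{k+1}=J_{\lambda A}\bigl(x_k-\lambda B(x_k)-\lambda\bigl(B_{i_k}(x_k)-B_{i_k}(x_{k-1})\bigr)\bigr),\qquad k=0,1,2,\dots,$$ where $J_{\lambda A}=(I+\lambda A)^{-1}$ is the resolvent of $\lambda A$. Then, almost surely, $(x_k)$ converges weakly to a point of $(A+B)^{-1}(0)$; the limit, which may depend on the realization, is a random variable with values in $(A+B)^{-1}(0)$. -/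

import Mathlib

open MeasureTheory ProbabilityTheory Filter Topology
open scoped Pointwise NNReal ENNReal

section MonotoneOperators

variable {H : Type*} [NormedAddCommGroup H] [InnerProductSpace ℝ H]

/-- A set-valued operator `A : H ⇉ H`, given as a map `H → Set H`, is monotone. -/
def IsMonotoneOperator (A : H → Set H) : Prop :=
  ∀ x y : H, ∀ u ∈ A x, ∀ v ∈ A y, 0 ≤ inner ℝ (x - y) (u - v)

/-- `A` is maximally monotone: it is monotone, and every monotone operator whose graph contains
the graph of `A` is equal to `A` (the order on `H → Set H` is inclusion of graphs). -/
def IsMaximallyMonotone (A : H → Set H) : Prop :=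
  Maximal IsMonotoneOperator A

/-- A single-valued operator `B : H → H` regarded as a set-valued one. -/
def toSetValued (B : H → H) : H → Set H := fun x => {B x}

/-- The set of zeros `A⁻¹(0)` of a set-valued operator. -/
def operatorZeros (A : H → Set H) : Set H := {x | (0 : H) ∈ A x}

/-- The values of the set-valued resolvent `(I + A)⁻¹` at `z`: all `y` with `z ∈ (I + A)(y)`. -/
def operatorResolventSet (A : H → Set H) (z : H) : Set H := {y | z ∈ toSetValued id y + A y}

/-- The resolvent `J_A = (I + A)⁻¹` as a map. When `A` is maximally monotone, `operatorResolventSet A z`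
is a singleton for every `z`, and this is its element. -/
noncomputable def operatorResolvent (A : H → Set H) (z : H) : H :=
  Classical.epsilon fun y => y ∈ operatorResolventSet A z

theorem mem_operatorResolventSet {A : H → Set H} {z y : H} : y ∈ operatorResolventSet A z ↔ z - y ∈ A y := by
  simp only [operatorResolventSet, toSetValued, Set.mem_ofPred_eq, id, Set.singleton_add,
    Set.mem_image]
  constructor
  · rintro ⟨u, hu, rfl⟩
    simpa using hu
  · intro h
    exact ⟨z - y, h, by abel⟩

/-- For a monotone operator no choice is involved in `operatorResolvent`. -/
theorem operatorResolvent_eq_of_mem {A : H → Set H} (hA : IsMonotoneOperator A) {z y : H}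
    (hy : y ∈ operatorResolventSet A z) : operatorResolvent A z = y := by
  have hw : operatorResolvent A z ∈ operatorResolventSet A z :=
    Classical.epsilon_spec (p := fun y => y ∈ operatorResolventSet A z) ⟨y, hy⟩
  have h := hA _ _ _ (mem_operatorResolventSet.1 hw) _ (mem_operatorResolventSet.1 hy)
  have e : z - operatorResolvent A z - (z - y) = -(operatorResolvent A z - y) := by abel
  rw [e, inner_neg_right, real_inner_self_eq_norm_sq] at h
  have h0 : ‖operatorResolvent A z - y‖ = 0 := by nlinarith [norm_nonneg (operatorResolvent A z - y)]
  exact sub_eq_zero.1 (norm_eq_zero.1 h0)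

end MonotoneOperators

/-! For a zero `z` of `A + B`, consider the energy `‖x_k - z‖² - 2λ⟨B x_k - B x_{k-1}, x_k - z⟩ +
λL‖x_k - x_{k-1}‖²`. Monotonicity of `A` and of `B` between `x_{k+1}` and `z` shows that one step
lowers it by at least `(1 - 2λL)‖x_{k+1} - x_k‖²`, up to a term linear in the sampling error of
`B_{i_k}` (`reflectedEnergy_step`). That term has mean zero given the past. The energy dominates `(1
- λL)‖x_k - z‖²`, so supermartingale convergence (`ae_tendsto_of_setIntegral_add_le`) makes it
converge almost surely and the increments vanish; hence `‖x_k - z‖` converges.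

The exceptional null set depends on `z`. A countable dense set of zeros suffices, because
convergence of distances passes to the closure.

The rest is deterministic on each path. Vanishing increments give residuals in `(A + B)(x_k)`
tending to `0`, so weak cluster points are zeros (`mem_operatorZeros_of_weak_limit`), and Opial's
lemma leaves only one. Minty's theorem makes the resolvent total. -/

/-! ### Minty's theorem and the resolvent. -/

section Minty

/-- A closed convex set of pairs `(p, t)` on which `t + ‖p‖² / 2` is bounded below contains a
minimiser of this function, which satisfies the corresponding variational inequality. -/
theorem exists_variational_inequality {K : Type*} [NormedAddCommGroup K] [InnerProductSpace ℝ K]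
    [CompleteSpace K] {E : Set (K × ℝ)} (hcl : IsClosed E) (hconv : Convex ℝ E) (hne : E.Nonempty)
    (hbdd : ∀ q ∈ E, 0 ≤ q.2 + ‖q.1‖ ^ 2 / 2) :
    ∃ p ∈ E, ∀ q ∈ E, p.2 + ‖p.1‖ ^ 2 ≤ q.2 + inner ℝ p.1 q.1 := by
  set f : K × ℝ → ℝ := fun q => q.2 + ‖q.1‖ ^ 2 / 2 with hf
  have hbelow : BddBelow (f '' E) := ⟨0, by rintro _ ⟨q, hq, rfl⟩; exact hbdd q hq⟩
  set m := sInf (f '' E) with hm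
  have hle : ∀ q ∈ E, m ≤ f q := fun q hq => csInf_le hbelow ⟨q, hq, rfl⟩
  have hex : ∀ k : ℕ, ∃ q ∈ E, f q < m + 1 / ((k : ℝ) + 1) := by
    intro k
    obtain ⟨_, ⟨q, hq, rfl⟩, h⟩ := exists_lt_of_csInf_lt (hne.image f)
      (show m < m + 1 / ((k : ℝ) + 1) by linarith [Nat.one_div_pos_of_nat (α := ℝ) (n := k)])
    exact ⟨q, hq, h⟩
  choose u huE hu using hex
  -- Comparing with the midpoint through the parallelogram law makes the first coordinates of a
  -- minimising sequence Cauchy; the second ones then converge because `f` does.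
  have hmid : ∀ p ∈ E, ∀ q ∈ E, ‖p.1 - q.1‖ ^ 2 ≤ 4 * (f p + f q - 2 * m) := by
    intro p hp q hq
    have h := hle _ (hconv hp hq (by norm_num : (0 : ℝ) ≤ 1 / 2) (by norm_num : (0 : ℝ) ≤ 1 / 2)
      (by norm_num))
    simp only [hf, Prod.fst_add, Prod.snd_add, Prod.smul_fst, Prod.smul_snd, smul_eq_mul,
      ← smul_add, norm_smul] at h ⊢
    norm_num at h
    have e := parallelogram_law_with_norm ℝ p.1 q.1
    nlinarith
  have hsmall : Tendsto (fun k : ℕ => 1 / ((k : ℝ) + 1)) atTop (𝓝 0) :=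
    tendsto_one_div_add_atTop_nhds_zero_nat
  have hcau : CauchySeq fun k => (u k).1 := by
    rw [Metric.cauchySeq_iff']
    intro ε hε
    obtain ⟨N, hN⟩ := (hsmall.eventually (gt_mem_nhds (show 0 < ε ^ 2 / 8 by positivity))).exists
    refine ⟨N, fun k hk => ?_⟩
    have h1 := hmid _ (huE k) _ (huE N)
    have h2 : 1 / ((k : ℝ) + 1) ≤ 1 / ((N : ℝ) + 1) := Nat.one_div_le_one_div hk
    have h3 := hu k
    have h4 := hu N
    rw [dist_eq_norm]
    exact lt_of_pow_lt_pow_left₀ 2 hε.le (by linarith)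
  obtain ⟨p, hp⟩ := cauchySeq_tendsto_of_complete hcau
  have hfu : Tendsto (fun k => f (u k)) atTop (𝓝 m) :=
    tendsto_of_tendsto_of_tendsto_of_le_of_le tendsto_const_nhds
      (by simpa using hsmall.const_add m) (fun k => hle _ (huE k)) fun k => (hu k).le
  have hu2 : Tendsto (fun k => (u k).2) atTop (𝓝 (m - ‖p‖ ^ 2 / 2)) := by
    simpa [hf] using hfu.sub ((hp.norm.pow 2).div_const 2)
  have hmem : (p, m - ‖p‖ ^ 2 / 2) ∈ E :=
    hcl.mem_of_tendsto (hp.prodMk_nhds hu2) (Eventually.of_forall huE)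
  refine ⟨_, hmem, fun q hq => ?_⟩
  -- `c` is the directional derivative of `f` at the minimiser towards `q`.
  set c := q.2 - (m - ‖p‖ ^ 2 / 2) + inner ℝ p (q.1 - p) with hc
  have key : ∀ s : ℝ, 0 < s → s ≤ 1 → 0 ≤ c + s / 2 * ‖q.1 - p‖ ^ 2 := by
    intro s hs hs1
    have h := hle _ (hconv.add_smul_sub_mem hmem hq ⟨hs.le, hs1⟩)
    simp only [hf, Prod.fst_add, Prod.snd_add, Prod.smul_fst, Prod.smul_snd, Prod.fst_sub,
      Prod.snd_sub, smul_eq_mul] at h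
    rw [norm_add_sq_real, norm_smul, inner_smul_right, Real.norm_of_nonneg hs.le] at h
    have h' : 0 ≤ s * (c + s / 2 * ‖q.1 - p‖ ^ 2) := by rw [hc]; nlinarith
    exact nonneg_of_mul_nonneg_right h' hs
  have hc0 : 0 ≤ c := by
    by_contra! hneg
    have hD : 0 ≤ ‖q.1 - p‖ ^ 2 := by positivity
    have hs : 0 < min 1 (-c / (‖q.1 - p‖ ^ 2 + 1)) := lt_min one_pos (by
      apply div_pos <;> linarith)
    have h := key _ hs (min_le_left _ _)
    have h2 := min_le_right 1 (-c / (‖q.1 - p‖ ^ 2 + 1))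
    rw [le_div_iff₀ (by linarith)] at h2
    nlinarith
  rw [hc, inner_sub_right, real_inner_self_eq_norm_sq] at hc0
  dsimp only
  linarith

variable {H : Type*} [NormedAddCommGroup H] [InnerProductSpace ℝ H]

/-- A point that is monotonically related to the graph of a maximally monotone operator lies
in the graph. -/
theorem IsMaximallyMonotone.mem_of_forall_inner_nonneg {A : H → Set H} (hA : IsMaximallyMonotone A)
    {x u : H} (h : ∀ a, ∀ b ∈ A a, 0 ≤ inner ℝ (x - a) (u - b)) : u ∈ A x := by
  have hmono : IsMonotoneOperator fun y => A y ∪ {v | y = x ∧ v = u} := by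
    rintro y y' v (hv | ⟨rfl, rfl⟩) v' (hv' | ⟨rfl, rfl⟩)
    · exact hA.1 _ _ _ hv _ hv'
    · rw [← neg_sub y', ← neg_sub v', inner_neg_neg]
      exact h _ _ hv
    · exact h _ _ hv'
    · simp
  exact hA.2 hmono (fun y => Set.subset_union_left) x (Or.inr ⟨rfl, rfl⟩)

/-- **Minty's theorem** at the origin: `0` lies in the range of `I + A`. -/
theorem exists_neg_mem_of_maximal [CompleteSpace H] {A : H → Set H} (hA : IsMonotoneOperator A)
    (hmax : ∀ x u, (∀ a, ∀ b ∈ A a, 0 ≤ inner ℝ (x - a) (u - b)) → u ∈ A x) :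
    ∃ y, -y ∈ A y := by
  obtain ⟨a₀, b₀, h₀⟩ : ∃ a, ∃ b, b ∈ A a := by
    by_contra! hno
    exact hno 0 0 (hmax 0 0 fun a b hb => absurd hb (hno a b))
  -- The epigraph of the Fitzpatrick function of `A`, the supremum of `⟨x, b⟩ + ⟨a, u⟩ - ⟨a, b⟩`
  -- over the graph.
  set E : Set (WithLp 2 (H × H) × ℝ) :=
    {q | ∀ a, ∀ b ∈ A a, inner ℝ q.1.fst b + inner ℝ a q.1.snd - inner ℝ a b ≤ q.2} with hE
  have hgraph : ∀ a, ∀ b ∈ A a, ((WithLp.toLp 2 (a, b), inner ℝ a b) : WithLp 2 (H × H) × ℝ) ∈ E := by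
    intro a b hb a' b' hb'
    have h := hA _ _ _ hb _ hb'
    simp only [inner_sub_left, inner_sub_right] at h
    change inner ℝ a b' + inner ℝ a' b - inner ℝ a' b' ≤ inner ℝ a b
    linarith
  -- A strict reverse inequality would make `(x, u)` monotonically related to the graph, hence a
  -- point of it, and testing against that point itself gives a contradiction.
  have hlow : ∀ q ∈ E, inner ℝ q.1.fst q.1.snd ≤ q.2 := by
    intro q hq
    by_contra! hlt
    have hmem : q.1.snd ∈ A q.1.fst := by
      refine hmax _ _ fun a b hb => ?_
      have h := hq a b hb
      simp only [inner_sub_left, inner_sub_right]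
      linarith
    have h := hq _ _ hmem
    linarith
  have hcl : IsClosed E := by
    simp only [hE, Set.ofPred_forall]
    refine isClosed_iInter fun a => isClosed_iInter fun b => isClosed_iInter fun hb => ?_
    refine isClosed_le ?_ continuous_snd
    have h1 : Continuous fun q : WithLp 2 (H × H) × ℝ => q.1.fst :=
      (WithLp.prod_continuous_ofLp 2 H H).fst.comp continuous_fst
    have h2 : Continuous fun q : WithLp 2 (H × H) × ℝ => q.1.snd :=
      (WithLp.prod_continuous_ofLp 2 H H).snd.comp continuous_fst
    fun_prop
  have hconv : Convex ℝ E := by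
    intro p hp q hq s t hs ht hst a b hb
    have h1 := mul_le_mul_of_nonneg_left (hp a b hb) hs
    have h2 := mul_le_mul_of_nonneg_left (hq a b hb) ht
    simp only [Prod.fst_add, Prod.snd_add, Prod.smul_fst, Prod.smul_snd, WithLp.add_fst,
      WithLp.add_snd, WithLp.smul_fst, WithLp.smul_snd, inner_add_left, inner_add_right,
      inner_smul_left, inner_smul_right, smul_eq_mul, RCLike.conj_to_real]
    have e : t = 1 - s := by linarith
    subst e
    linarith
  obtain ⟨p, hp, hvar⟩ := exists_variational_inequality hcl hconv ⟨_, hgraph a₀ b₀ h₀⟩ (by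
    intro q hq
    have h := hlow q hq
    have h2 := norm_add_sq_real q.1.fst q.1.snd
    rw [WithLp.prod_norm_sq_eq_of_L2]
    nlinarith [sq_nonneg ‖q.1.fst + q.1.snd‖])
  have hp2 := hlow p hp
  -- With `p.1 = (x, u)`, this puts `(-u, -x)` in the graph; taking `(a, b)` to be that point then
  -- forces `x + u = 0`.
  have key : ∀ a, ∀ b ∈ A a,
      ‖p.1.fst + p.1.snd‖ ^ 2 ≤ inner ℝ (-p.1.snd - a) (-p.1.fst - b) := by
    intro a b hb
    have h := hvar _ (hgraph a b hb)
    rw [WithLp.prod_norm_sq_eq_of_L2, WithLp.prod_inner_apply] at h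
    simp only [WithLp.ofLp_fst, WithLp.ofLp_snd] at h
    rw [norm_add_sq_real]
    simp only [inner_sub_left, inner_sub_right, inner_neg_left, inner_neg_right]
    rw [real_inner_comm p.1.fst p.1.snd, real_inner_comm p.1.fst a]
    linarith
  have hmem := hmax _ _ fun a b hb => (sq_nonneg _).trans (key a b hb)
  have h0 := key _ _ hmem
  rw [sub_self, inner_zero_left] at h0
  have hz : p.1.fst + p.1.snd = 0 := by
    rw [← norm_eq_zero]
    exact pow_eq_zero_iff two_ne_zero |>.1 (le_antisymm h0 (sq_nonneg _))
  refine ⟨p.1.fst, ?_⟩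
  rwa [← eq_neg_of_add_eq_zero_left hz] at hmem

variable [CompleteSpace H] {A : H → Set H} {r : ℝ}

/-- The resolvent of a maximally monotone operator is defined everywhere. -/
theorem IsMaximallyMonotone.inv_smul_sub_resolvent_mem (hA : IsMaximallyMonotone A) (hr : 0 < r)
    (z : H) :
    r⁻¹ • (z - operatorResolvent (r • A) z) ∈ A (operatorResolvent (r • A) z) := by
  -- Minty's theorem at the origin is applied to the translate `r • A - z`.
  obtain ⟨y, hy⟩ : ∃ y, -y ∈ {v | r⁻¹ • (z + v) ∈ A y} := by
    refine exists_neg_mem_of_maximal (A := fun y => {v | r⁻¹ • (z + v) ∈ A y}) ?_ ?_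
    · intro a a' b hb b' hb'
      have h := hA.1 _ _ _ hb _ hb'
      rw [← smul_sub, add_sub_add_left_eq_sub, inner_smul_right] at h
      exact nonneg_of_mul_nonneg_right h (inv_pos.2 hr)
    · intro a b h
      refine hA.mem_of_forall_inner_nonneg fun a' b' hb' => ?_
      have h' := h a' (r • b' - z) (by
        change r⁻¹ • (z + (r • b' - z)) ∈ A a'
        rwa [add_sub_cancel, inv_smul_smul₀ hr.ne'])
      have e : r⁻¹ • (z + b) - b' = r⁻¹ • (b - (r • b' - z)) := by
        simp only [smul_sub, smul_add, smul_smul, inv_mul_cancel₀ hr.ne', one_smul]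
        abel
      rw [e, inner_smul_right]
      exact mul_nonneg (inv_pos.2 hr).le h'
  have hmono : IsMonotoneOperator (r • A) := by
    rintro a a' _ ⟨b, hb, rfl⟩ _ ⟨b', hb', rfl⟩
    have := hA.1 _ _ _ hb _ hb'
    simp only [← smul_sub, inner_smul_right]
    positivity
  rw [operatorResolvent_eq_of_mem hmono (y := y)]
  · simpa [sub_eq_add_neg] using hy
  · rw [mem_operatorResolventSet, Pi.smul_apply, Set.mem_smul_set_iff_inv_smul_mem₀ hr.ne']
    simpa [sub_eq_add_neg] using hy

/-- Monotonicity at two resolvent points gives `‖Jz - Jw‖² ≤ ⟨Jz - Jw, z - w⟩`; Cauchy–Schwarz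
finishes. -/
theorem IsMaximallyMonotone.lipschitzWith_resolvent (hA : IsMaximallyMonotone A) (hr : 0 < r) :
    LipschitzWith 1 (operatorResolvent (r • A)) := by
  refine LipschitzWith.of_dist_le_mul fun z w => ?_
  have h := hA.1 _ _ _ (hA.inv_smul_sub_resolvent_mem hr z) _ (hA.inv_smul_sub_resolvent_mem hr w)
  rw [← smul_sub, inner_smul_right] at h
  have h' := nonneg_of_mul_nonneg_right h (inv_pos.2 hr)
  rw [sub_sub_sub_comm, inner_sub_right, real_inner_self_eq_norm_sq] at h'
  have h2 := real_inner_le_norm (operatorResolvent (r • A) z - operatorResolvent (r • A) w) (z - w)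
  rw [dist_eq_norm, dist_eq_norm, NNReal.coe_one, one_mul]
  by_contra! hlt
  nlinarith [norm_nonneg (z - w)]

end Minty

/-! ### Weak limits: Opial's lemma, demiclosedness, measurability. -/

section WeakConvergence

variable {H : Type*} [NormedAddCommGroup H] [InnerProductSpace ℝ H]

/-- Convergence in the weak topology of a Hilbert space is tested by inner products. -/
theorem tendsto_toWeakSpace_iff_inner [CompleteSpace H] {ι : Type*} {l : Filter ι} {y : ι → H}
    {p : H} :
    Tendsto (fun k => toWeakSpace ℝ H (y k)) l (𝓝 (toWeakSpace ℝ H p)) ↔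
      ∀ v, Tendsto (fun k => inner ℝ v (y k)) l (𝓝 (inner ℝ v p)) := by
  have hinj : Function.Injective (topDualPairing ℝ H).flip := by
    intro a b hab
    refine ext_inner_left ℝ fun v => ?_
    exact DFunLike.congr_fun hab (InnerProductSpace.toDual ℝ H v)
  refine (WeakBilin.tendsto_iff_forall_eval_tendsto _ hinj).trans ⟨fun h v => ?_, fun h f => ?_⟩
  · exact h (InnerProductSpace.toDual ℝ H v)
  · obtain ⟨v, rfl⟩ := (InnerProductSpace.toDual ℝ H).surjective f
    exact h v

/-- A bounded family in a Hilbert space converges weakly along every ultrafilter. -/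
theorem exists_weak_limit_ultrafilter [CompleteSpace H] {ι : Type*} {y : ι → H} {C : ℝ}
    (hC : ∀ k, ‖y k‖ ≤ C) (U : Ultrafilter ι) :
    ∃ p : H, ∀ v, Tendsto (fun k => inner ℝ v (y k)) U (𝓝 (inner ℝ v p)) := by
  let φ : ι → WeakDual ℝ H := fun k => StrongDual.toWeakDual (InnerProductSpace.toDual ℝ H (y k))
  obtain ⟨f, -, hf⟩ := (WeakDual.isCompact_closedBall (𝕜 := ℝ) (E := H) 0 C).ultrafilter_le_nhds
    (U.map φ) (by
      rw [le_principal_iff]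
      refine Filter.Eventually.of_forall (f := (U : Filter ι)) fun k => ?_
      change InnerProductSpace.toDual ℝ H (y k) ∈ Metric.closedBall 0 C
      rw [mem_closedBall_zero_iff, LinearIsometryEquiv.norm_map]
      exact hC k)
  obtain ⟨p, hp⟩ := (InnerProductSpace.toDual ℝ H).surjective (WeakDual.toStrongDual f)
  refine ⟨p, fun v => ?_⟩
  have h : Tendsto (fun k => φ k v) U (𝓝 (f v)) := (WeakDual.eval_continuous v).continuousAt.tendsto.comp hf
  have e : f v = inner ℝ v p := by
    rw [real_inner_comm]
    exact (DFunLike.congr_fun hp v).symm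
  rw [← e]
  refine h.congr fun k => ?_
  rw [real_inner_comm]
  rfl

/-- **Opial's lemma**, with weak cluster points taken along ultrafilters. -/
theorem exists_weak_limit_of_tendsto_norm_sub [CompleteSpace H] {y : ℕ → H} {Z : Set H}
    (hne : Z.Nonempty) (hnorm : ∀ z ∈ Z, ∃ c, Tendsto (fun k => ‖y k - z‖) atTop (𝓝 c))
    (hcluster : ∀ U : Ultrafilter ℕ, (U : Filter ℕ) ≤ atTop → ∀ p,
      (∀ v, Tendsto (fun k => inner ℝ v (y k)) U (𝓝 (inner ℝ v p))) → p ∈ Z) :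
    ∃ p ∈ Z, ∀ v, Tendsto (fun k => inner ℝ v (y k)) atTop (𝓝 (inner ℝ v p)) := by
  obtain ⟨z, hz⟩ := hne
  obtain ⟨C, hC⟩ : ∃ C, ∀ k, ‖y k‖ ≤ C := by
    obtain ⟨c, hc⟩ := hnorm z hz
    obtain ⟨C, hC⟩ := hc.bddAbove_range
    exact ⟨C + ‖z‖, fun k => by
      linarith [norm_le_norm_sub_add (y k) z, hC (Set.mem_range_self k)]⟩
  have hlim := fun U : Ultrafilter ℕ => exists_weak_limit_ultrafilter hC U
  obtain ⟨p, hp⟩ := hlim (Ultrafilter.of atTop)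
  have hpZ := hcluster _ (Ultrafilter.of_le _) p hp
  refine ⟨p, hpZ, fun v => (tendsto_iff_ultrafilter _ _ _).2 fun U hU => ?_⟩
  obtain ⟨q, hq⟩ := hlim U
  have hqZ := hcluster U hU q hq
  suffices hqp : q = p by rw [← hqp]; exact hq v
  obtain ⟨c, hc⟩ := hnorm p hpZ
  obtain ⟨d, hd⟩ := hnorm q hqZ
  -- `⟨q - p, y k⟩` is an affine function of `‖y k - p‖² - ‖y k - q‖²`, so it has a full limit and
  -- cannot separate the cluster points `p` and `q`.
  have hin : Tendsto (fun k => inner ℝ (q - p) (y k)) atTop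
      (𝓝 ((c ^ 2 - d ^ 2 + ‖q‖ ^ 2 - ‖p‖ ^ 2) / 2)) := by
    refine (((((hc.pow 2).sub (hd.pow 2)).add_const (‖q‖ ^ 2)).sub_const (‖p‖ ^ 2)).div_const
      2).congr fun k => ?_
    rw [norm_sub_sq_real, norm_sub_sq_real, inner_sub_left, real_inner_comm q, real_inner_comm p]
    ring
  have e1 := tendsto_nhds_unique (hin.mono_left hU) (hq (q - p))
  have e2 := tendsto_nhds_unique (hin.mono_left (Ultrafilter.of_le _)) (hp (q - p))
  have e3 : inner ℝ (q - p) (q - p) = 0 := by rw [inner_sub_right, ← e1, ← e2, sub_self]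
  exact sub_eq_zero.1 (inner_self_eq_zero.1 e3)

omit [InnerProductSpace ℝ H] in
theorem mem_operatorZeros_add_toSetValued {A : H → Set H} {B : H → H} {x : H} :
    x ∈ operatorZeros (A + toSetValued B) ↔ -B x ∈ A x := by
  change (0 : H) ∈ A x + {B x} ↔ _
  rw [Set.add_singleton, Set.mem_image]
  constructor
  · rintro ⟨u, hu, h⟩
    rwa [← eq_neg_of_add_eq_zero_left h]
  · exact fun h => ⟨_, h, by simp⟩

/-- The graph of `A + B` is closed for weak convergence of arguments and strong convergence to `0`
of values. -/
theorem mem_operatorZeros_of_weak_limit [CompleteSpace H] {A : H → Set H}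
    (hA : IsMaximallyMonotone A) {B : H → H} (hB : IsMonotoneOperator (toSetValued B)) {L : ℝ≥0}
    (hL : LipschitzWith L B) {ι : Type*} {l : Filter ι} [l.NeBot] {y w : ι → H} {C : ℝ}
    (hC : ∀ k, ‖y k‖ ≤ C) (hw : Tendsto w l (𝓝 0)) (hmem : ∀ k, w k - B (y k) ∈ A (y k)) {p : H}
    (hp : ∀ v, Tendsto (fun k => inner ℝ v (y k)) l (𝓝 (inner ℝ v p))) :
    p ∈ operatorZeros (A + toSetValued B) := by
  -- For small `r` the resolvent of `r(A + B)` at `p` is the fixed point `q` of a contraction, so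
  -- maximality of `A + B` is not needed. Testing monotonicity at `q` against `(y k, w k)` gives `‖p
  -- - q‖² ≤ 0` in the limit.
  obtain ⟨r, hr, hrL⟩ : ∃ r : ℝ≥0, 0 < r ∧ r * L < 1 := by
    refine ⟨(L + 1)⁻¹, by positivity, ?_⟩
    rw [inv_mul_lt_iff₀ (by positivity), mul_one]
    exact lt_add_one L
  have hr' : (0 : ℝ) < r := hr
  have hcontr : ContractingWith (r * L) fun q => operatorResolvent ((r : ℝ) • A) (p - (r : ℝ) • B q) := by
    refine ⟨hrL, LipschitzWith.of_dist_le_mul fun a b => ?_⟩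
    refine ((hA.lipschitzWith_resolvent hr').dist_le_mul _ _).trans ?_
    have h := hL.dist_le_mul a b
    rw [NNReal.coe_one, one_mul, dist_sub_left, dist_smul₀, NNReal.coe_mul, mul_assoc,
      Real.norm_of_nonneg hr'.le]
    gcongr
  obtain ⟨q, hq⟩ : ∃ q, operatorResolvent ((r : ℝ) • A) (p - (r : ℝ) • B q) = q :=
    ⟨_, hcontr.fixedPoint_isFixedPt⟩
  have hqA := hA.inv_smul_sub_resolvent_mem hr' (p - (r : ℝ) • B q)
  rw [hq] at hqA
  have hineq : ∀ k, (r : ℝ)⁻¹ * inner ℝ (p - q) (y k - q) ≤ inner ℝ (y k - q) (w k) := by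
    intro k
    have h1 := hA.1 _ _ _ (hmem k) _ hqA
    have h2 := hB (y k) q _ rfl _ rfl
    have e : w k - B (y k) - (r : ℝ)⁻¹ • (p - (r : ℝ) • B q - q)
        = w k - (B (y k) - B q) - (r : ℝ)⁻¹ • (p - q) := by
      rw [sub_right_comm p, smul_sub, inv_smul_smul₀ hr'.ne']
      abel
    rw [e, inner_sub_right, inner_sub_right, inner_smul_right] at h1
    rw [real_inner_comm]
    linarith
  have hlim1 : Tendsto (fun k => (r : ℝ)⁻¹ * inner ℝ (p - q) (y k - q)) l
      (𝓝 ((r : ℝ)⁻¹ * inner ℝ (p - q) (p - q))) := by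
    refine Tendsto.const_mul _ ?_
    simp only [inner_sub_right _ _ q]
    exact (hp (p - q)).sub_const _
  have hlim2 : Tendsto (fun k => inner ℝ (y k - q) (w k)) l (𝓝 0) := by
    refine squeeze_zero_norm (a := fun k => (C + ‖q‖) * ‖w k‖) (fun k => ?_) ?_
    · refine (norm_inner_le_norm _ _).trans ?_
      gcongr
      exact (norm_sub_le _ _).trans (by gcongr; exact hC k)
    · simpa using hw.norm.const_mul (C + ‖q‖)
  have h0 := le_of_tendsto_of_tendsto' hlim1 hlim2 hineq
  rw [real_inner_self_eq_norm_sq] at h0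
  have hpq : p = q := by
    rw [← sub_eq_zero, ← norm_eq_zero]
    have : ‖p - q‖ ^ 2 ≤ 0 := by
      by_contra! h
      exact absurd h0 (not_le.2 (mul_pos (inv_pos.2 hr') h))
    exact pow_eq_zero_iff two_ne_zero |>.1 (le_antisymm this (sq_nonneg _))
  rw [mem_operatorZeros_add_toSetValued]
  rw [← hpq, sub_right_comm, sub_self, zero_sub, smul_neg, inv_smul_smul₀ hr'.ne'] at hqA
  exact hqA

omit [InnerProductSpace ℝ H] in
/-- Convergence of the distances to `z` passes to limits in `z`. -/
theorem exists_tendsto_norm_sub_of_mem_closure {y : ℕ → H} {D : Set H}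
    (hD : ∀ z ∈ D, ∃ c, Tendsto (fun k => ‖y k - z‖) atTop (𝓝 c)) {z : H} (hz : z ∈ closure D) :
    ∃ c, Tendsto (fun k => ‖y k - z‖) atTop (𝓝 c) := by
  refine cauchySeq_tendsto_of_complete (Metric.cauchySeq_iff'.2 fun ε hε => ?_)
  obtain ⟨d, hd, hzd⟩ := Metric.mem_closure_iff.1 hz (ε / 3) (by positivity)
  obtain ⟨c, hc⟩ := hD d hd
  obtain ⟨N, hN⟩ := Metric.cauchySeq_iff'.1 hc.cauchySeq (ε / 3) (by positivity)
  refine ⟨N, fun k hk => ?_⟩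
  have h1 : ∀ j, dist ‖y j - z‖ ‖y j - d‖ ≤ dist z d := fun j => by
    simpa [dist_eq_norm] using (dist_norm_norm_le (y j - z) (y j - d)).trans_eq (by
      rw [sub_sub_sub_cancel_left, norm_sub_rev])
  have h2 := dist_triangle4 ‖y k - z‖ ‖y k - d‖ ‖y N - d‖ ‖y N - z‖
  have h3 := h1 N
  rw [dist_comm] at h3
  linarith [h1 k, hN k hk]

/-- A weak pointwise limit of measurable functions into a separable Hilbert space is measurable. -/
theorem measurable_of_tendsto_inner [TopologicalSpace.SeparableSpace H] [MeasurableSpace H]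
    [BorelSpace H] {Ω : Type*} [MeasurableSpace Ω] {f : ℕ → Ω → H} {g : Ω → H}
    (hf : ∀ k, Measurable (f k))
    (h : ∀ ω v, Tendsto (fun k => inner ℝ v (f k ω)) atTop (𝓝 (inner ℝ v (g ω)))) :
    Measurable g := by
  have : SecondCountableTopology H := UniformSpace.secondCountable_of_separable H
  have hin : ∀ v, Measurable fun ω => inner ℝ v (g ω) := fun v =>
    measurable_of_tendsto_metrizable (fun k => measurable_const.inner (hf k))
      (tendsto_pi_nhds.2 fun ω => h ω v)
  let d := TopologicalSpace.denseSeq H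
  have hball : ∀ c r, 0 ≤ r → MeasurableSet (g ⁻¹' Metric.closedBall c r) := by
    intro c r hr
    -- The norm is determined by inner products with a dense sequence, so a closed ball is a
    -- countable intersection of half-spaces.
    have e : g ⁻¹' Metric.closedBall c r
        = ⋂ j, {ω | inner ℝ (d j) (g ω) - inner ℝ (d j) c ≤ r * ‖d j‖} := by
      ext ω
      simp only [Set.mem_preimage, mem_closedBall_iff_norm, Set.mem_iInter, Set.mem_ofPred_eq,
        ← inner_sub_right]
      constructor
      · intro hle j
        refine (real_inner_le_norm _ _).trans ?_
        rw [mul_comm]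
        gcongr
      · intro hall
        have hext : ∀ v : H, inner ℝ v (g ω - c) ≤ r * ‖v‖ := by
          have hclosed : IsClosed {v : H | inner ℝ v (g ω - c) ≤ r * ‖v‖} :=
            isClosed_le (by fun_prop) (by fun_prop)
          intro v
          exact hclosed.closure_subset_iff.2 (Set.range_subset_iff.2 hall)
            (TopologicalSpace.denseRange_denseSeq H v)
        have hs := hext (g ω - c)
        rw [real_inner_self_eq_norm_sq] at hs
        by_contra! hlt
        nlinarith
    rw [e]
    exact MeasurableSet.iInter fun j =>
      measurableSet_le ((hin _).sub_const _) measurable_const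
  refine measurable_of_isOpen fun s hs => ?_
  have e : s = ⋃ j, ⋃ r : ℚ, ⋃ _ : (0 : ℝ) ≤ r ∧ Metric.closedBall (d j) (r : ℝ) ⊆ s,
      Metric.closedBall (d j) (r : ℝ) := by
    refine Set.Subset.antisymm (fun x hx => ?_) ?_
    · obtain ⟨ε, hε, hball⟩ := Metric.isOpen_iff.1 hs x hx
      obtain ⟨r, hr0, hrε⟩ := exists_rat_btwn (half_pos hε)
      obtain ⟨j, hj⟩ := (TopologicalSpace.denseRange_denseSeq H).exists_dist_lt x hr0
      simp only [Set.mem_iUnion]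
      refine ⟨j, r, ⟨hr0.le, fun v hv => hball ?_⟩, hj.le⟩
      rw [Metric.mem_closedBall] at hv
      rw [Metric.mem_ball]
      have := dist_triangle_right v x (d j)
      linarith
    · exact Set.iUnion_subset fun j => Set.iUnion_subset fun r => Set.iUnion_subset fun h => h.2
  rw [e, Set.preimage_iUnion]
  refine MeasurableSet.iUnion fun j => ?_
  rw [Set.preimage_iUnion]
  refine MeasurableSet.iUnion fun r => ?_
  rw [Set.preimage_iUnion]
  exact MeasurableSet.iUnion fun h => hball _ _ h.1

end WeakConvergence

/-! ### Averaging over the index and supermartingale convergence. -/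

section Probability

variable {Ω : Type*} [mΩ : MeasurableSpace Ω] {μ : Measure Ω}

/-- Averaging over an index that is uniformly distributed and independent of the integrands. -/
theorem setIntegral_apply_uniform {Ω : Type*} {m mΩ : MeasurableSpace Ω} {μ : Measure Ω}
    [IsProbabilityMeasure μ] {n : ℕ}
    (hm : m ≤ mΩ) {i : Ω → Fin n} (hi : Measurable i)
    (hindep : Indep m (MeasurableSpace.comap i ⊤) μ)
    (hunif : ∀ j, μ {ω | i ω = j} = (n : ℝ≥0∞)⁻¹) {G : Fin n → Ω → ℝ}
    (hG : ∀ j, StronglyMeasurable[m] (G j)) (hint : ∀ j, Integrable (G j) μ) {s : Set Ω}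
    (hs : MeasurableSet[m] s) :
    ∫ ω in s, G (i ω) ω ∂μ = (n : ℝ)⁻¹ * ∫ ω in s, ∑ j, G j ω ∂μ := by
  have hlevel : ∀ j, MeasurableSet {ω | i ω = j} := fun j => hi (measurableSet_singleton j)
  have hsum : ∀ ω, G (i ω) ω = ∑ j, {ω | i ω = j}.indicator (G j) ω := by
    intro ω
    rw [Finset.sum_eq_single (i ω)]
    · rw [Set.indicator_of_mem (by simp)]
    · intro j _ hj
      exact Set.indicator_of_notMem (fun h => hj h.symm) _
    · simp
  simp_rw [hsum]
  rw [integral_finsetSum _ fun j _ => ((hint j).indicator (hlevel j)).integrableOn,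
    integral_finsetSum _ fun j _ => (hint j).integrableOn, Finset.mul_sum]
  refine Finset.sum_congr rfl fun j _ => ?_
  -- The first factor is `m`-measurable and the second depends on `i` alone, so the integral of the
  -- product factors.
  have hind : IndepFun (s.indicator (G j)) ({ω | i ω = j}.indicator fun _ => (1 : ℝ)) μ := by
    rw [IndepFun_iff_Indep]
    refine indep_of_indep_of_le_left (indep_of_indep_of_le_right hindep ?_) ?_
    · refine Measurable.comap_le (m₁ := MeasurableSpace.comap i ⊤) ?_
      exact measurable_const.indicator ⟨{j}, trivial, rfl⟩
    · exact Measurable.comap_le ((hG j).measurable.indicator hs)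
  have h := hind.integral_mul_eq_mul_integral
    (((hG j).mono hm).indicator (hm _ hs)).aestronglyMeasurable
    (stronglyMeasurable_const.indicator (hlevel j)).aestronglyMeasurable
  rw [integral_indicator (hm _ hs), integral_indicator_const _ (hlevel j), smul_eq_mul,
    mul_one] at h
  rw [← integral_indicator (hm _ hs), mul_comm, ← ENNReal.toReal_natCast n, ← ENNReal.toReal_inv,
    ← hunif j]
  refine Eq.trans ?_ h
  congr 1 with ω
  by_cases h1 : ω ∈ s <;> by_cases h2 : ω ∈ {ω | i ω = j} <;> simp [h1, h2]

/-- A nonnegative supermartingale converges almost surely. -/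
theorem MeasureTheory.Supermartingale.exists_ae_tendsto_of_nonneg [IsFiniteMeasure μ]
    {ℱ : Filtration ℕ mΩ} {W : ℕ → Ω → ℝ} (hW : Supermartingale W ℱ μ) (hpos : ∀ k ω, 0 ≤ W k ω) :
    ∀ᵐ ω ∂μ, ∃ c, Tendsto (fun k => W k ω) atTop (𝓝 c) := by
  have hbdd : ∀ k, eLpNorm ((-W) k) 1 μ ≤ (Real.toNNReal (∫ ω, W 0 ω ∂μ) : ℝ≥0∞) := by
    intro k
    rw [Pi.neg_apply, eLpNorm_neg, eLpNorm_one_eq_lintegral_enorm,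
      ← ofReal_integral_norm_eq_lintegral_enorm (hW.integrable k)]
    refine ENNReal.ofReal_le_ofReal ?_
    simp_rw [Real.norm_of_nonneg (hpos k _)]
    simpa using hW.setIntegral_le (Nat.zero_le k) MeasurableSet.univ
  filter_upwards [hW.neg.exists_ae_tendsto_of_bdd hbdd] with ω hω
  obtain ⟨c, hc⟩ := hω
  exact ⟨-c, by simpa using hc.neg⟩

/-- A form of the Robbins–Siegmund theorem: if `V` decreases in conditional expectation at least
by the nonnegative `D`, then almost surely `V` converges and `D` tends to `0`. -/
theorem ae_tendsto_of_setIntegral_add_le [IsFiniteMeasure μ] {ℱ : Filtration ℕ mΩ}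
    {V D : ℕ → Ω → ℝ} (hVm : ∀ k, StronglyMeasurable[ℱ k] (V k))
    (hDm : ∀ k, StronglyMeasurable[ℱ (k + 1)] (D k)) (hVi : ∀ k, Integrable (V k) μ)
    (hDi : ∀ k, Integrable (D k) μ) (hV0 : ∀ k ω, 0 ≤ V k ω) (hD0 : ∀ k ω, 0 ≤ D k ω)
    (h : ∀ k s, MeasurableSet[ℱ k] s → ∫ ω in s, (V (k + 1) ω + D k ω) ∂μ ≤ ∫ ω in s, V k ω ∂μ) :
    ∀ᵐ ω ∂μ, (∃ c, Tendsto (fun k => V k ω) atTop (𝓝 c)) ∧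
      Tendsto (fun k => D k ω) atTop (𝓝 0) := by
  have hSi : ∀ k, Integrable (fun ω => ∑ j ∈ Finset.range k, D j ω) μ := fun k =>
    integrable_finsetSum _ fun j _ => hDi j
  -- Adding the past decrements to `V` keeps a nonnegative supermartingale; its pathwise boundedness
  -- makes `D` summable.
  have hsuper : Supermartingale (fun k ω => V k ω + ∑ j ∈ Finset.range k, D j ω) ℱ μ := by
    refine supermartingale_of_setIntegral_succ_le (fun k => (hVm k).add ?_)
      (fun k => (hVi k).add (hSi k)) fun k s hs => ?_
    · exact Finset.stronglyMeasurable_fun_sum _ fun j hj =>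
        (hDm j).mono (ℱ.mono (Finset.mem_range.1 hj))
    · simp_rw [Finset.sum_range_succ]
      have e : ∀ ω, V (k + 1) ω + (∑ j ∈ Finset.range k, D j ω + D k ω)
          = V (k + 1) ω + D k ω + ∑ j ∈ Finset.range k, D j ω := fun ω => by ring
      simp_rw [e]
      have hVD : Integrable (fun ω => V (k + 1) ω + D k ω) μ := (hVi (k + 1)).add (hDi k)
      rw [integral_add hVD.integrableOn (hSi k).integrableOn,
        integral_add (hVi k).integrableOn (hSi k).integrableOn]
      exact add_le_add (h k s hs) le_rfl
  filter_upwards [hsuper.exists_ae_tendsto_of_nonneg fun k ω =>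
    add_nonneg (hV0 k ω) (Finset.sum_nonneg fun j _ => hD0 j ω)] with ω hω
  obtain ⟨c, hc⟩ := hω
  obtain ⟨C, hC⟩ := hc.bddAbove_range
  have hsm : Summable fun j => D j ω := summable_of_sum_range_le (fun j => hD0 j ω) fun k =>
    (le_add_of_nonneg_left (hV0 k ω)).trans (hC (Set.mem_range_self k))
  refine ⟨⟨c - ∑' j, D j ω, ?_⟩, hsm.tendsto_atTop_zero⟩
  simpa using hc.sub hsm.hasSum.tendsto_sum_nat

/-- The filtration whose `k`-th σ-algebra is generated by the variables with index below `k`. -/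
def strictPastFiltration {α : Type*} [MeasurableSpace α] (i : ℕ → Ω → α)
    (hi : ∀ k, Measurable (i k)) : Filtration ℕ mΩ where
  seq k := ⨆ j ∈ Set.Iio k, MeasurableSpace.comap (i j) inferInstance
  mono' _ _ hkl := biSup_mono fun _ hj => lt_of_lt_of_le hj hkl
  le' _ := iSup₂_le fun j _ => (hi j).comap_le

theorem measurable_strictPastFiltration_succ {α : Type*} [MeasurableSpace α] {i : ℕ → Ω → α}
    (hi : ∀ k, Measurable (i k)) (k : ℕ) :
    Measurable[strictPastFiltration i hi (k + 1)] (i k) := by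
  rw [measurable_iff_comap_le]
  exact le_iSup₂_of_le (f := fun j (_ : j ∈ Set.Iio (k + 1)) => MeasurableSpace.comap (i j) _)
    k (Nat.lt_succ_self k) le_rfl

theorem indep_strictPastFiltration {α : Type*} [MeasurableSpace α] {i : ℕ → Ω → α}
    (hi : ∀ k, Measurable (i k)) (hindep : iIndepFun i μ) (k : ℕ) :
    Indep (strictPastFiltration i hi k) (MeasurableSpace.comap (i k) inferInstance) μ := by
  have h := indep_iSup_of_disjoint (fun j => (hi j).comap_le) hindep.iIndep
    (S := Set.Iio k) (T := {k}) (by simp)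
  rwa [iSup_singleton] at h

end Probability

/-! ### Energy estimates and convergence of a single path. -/

section ForwardReflectedBackward

variable {H : Type*} [NormedAddCommGroup H] [InnerProductSpace ℝ H]

/-- The Lyapunov function of the forward-reflected-backward iteration at a pair `(x_{k-1}, x_k)` of
consecutive iterates. -/
noncomputable def reflectedEnergy (B : H → H) (lam : ℝ) (L : ℝ≥0) (z : H) (p : H × H) : ℝ :=
  ‖p.2 - z‖ ^ 2 - 2 * lam * inner ℝ (B p.2 - B p.1) (p.2 - z) + lam * L * ‖p.2 - p.1‖ ^ 2

theorem continuous_reflectedEnergy {B : H → H} (hB : Continuous B) (lam : ℝ) (L : ℝ≥0) (z : H) :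
    Continuous (reflectedEnergy B lam L z) := by
  unfold reflectedEnergy
  fun_prop

theorem LipschitzWith.abs_inner_sub_le {b : H → H} {L : ℝ≥0} (hb : LipschitzWith L b)
    (u v w : H) : |inner ℝ (b u - b v) w| ≤ L * ‖u - v‖ * ‖w‖ := by
  refine (abs_real_inner_le_norm _ _).trans ?_
  gcongr
  simpa [dist_eq_norm] using hb.dist_le_mul u v

/-- By Lipschitz continuity and Young's inequality the cross term costs at most `λL(‖p.2 - p.1‖² +
‖p.2 - z‖²)`; the last term of the energy absorbs the first half. -/
theorem le_reflectedEnergy {B : H → H} {L : ℝ≥0} (hB : LipschitzWith L B) {lam : ℝ}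
    (hlam : 0 < lam) (z : H) (p : H × H) :
    (1 - lam * L) * ‖p.2 - z‖ ^ 2 ≤ reflectedEnergy B lam L z p := by
  have h := le_of_abs_le (hB.abs_inner_sub_le p.2 p.1 (p.2 - z))
  have hL : 0 ≤ lam * L := by positivity
  have h2 : lam * inner ℝ (B p.2 - B p.1) (p.2 - z) ≤ lam * (L * ‖p.2 - p.1‖ * ‖p.2 - z‖) := by
    gcongr
  have h3 := mul_nonneg hL (sq_nonneg (‖p.2 - p.1‖ - ‖p.2 - z‖))
  unfold reflectedEnergy
  linarith

theorem reflectedEnergy_nonneg {B : H → H} {L : ℝ≥0} (hB : LipschitzWith L B) {lam : ℝ}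
    (hlam : 0 < lam) (hlamL : 2 * lam * L < 1) (z : H) (p : H × H) :
    0 ≤ reflectedEnergy B lam L z p := by
  have : 0 ≤ lam * L := by positivity
  exact (mul_nonneg (by linarith) (sq_nonneg _)).trans (le_reflectedEnergy hB hlam z p)

/-- The one-step estimate for the iteration, before averaging over the random index. -/
theorem reflectedEnergy_step [CompleteSpace H] {A : H → Set H} (hA : IsMaximallyMonotone A)
    {B : H → H} (hB : IsMonotoneOperator (toSetValued B)) {L : ℝ≥0} {lam : ℝ} (hlam : 0 < lam)
    {b : H → H} (hb : LipschitzWith L b) {z : H} (hz : z ∈ operatorZeros (A + toSetValued B))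
    {y₀ y₁ y₂ : H}
    (hy : y₂ = operatorResolvent (lam • A) (y₁ - lam • B y₁ - lam • (b y₁ - b y₀))) :
    reflectedEnergy B lam L z (y₁, y₂) + (1 - 2 * lam * L) * ‖y₂ - y₁‖ ^ 2 ≤
      reflectedEnergy B lam L z (y₀, y₁) +
        2 * lam * inner ℝ ((B y₁ - B y₀) - (b y₁ - b y₀)) (y₁ - z) := by
  have hmem := hA.inv_smul_sub_resolvent_mem hlam (y₁ - lam • B y₁ - lam • (b y₁ - b y₀))
  rw [← hy] at hmem
  have h1 := hA.1 _ _ _ hmem _ (mem_operatorZeros_add_toSetValued.1 hz)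
  -- `B y₂ - B z` is split off to be dropped by monotonicity of `B`; `B y₂ - B y₁` becomes the cross
  -- term of the new energy.
  have e : lam⁻¹ • (y₁ - lam • B y₁ - lam • (b y₁ - b y₀) - y₂) - -B z
      = lam⁻¹ • (-(y₂ - y₁) - lam • (B y₂ - B z) + lam • (B y₂ - B y₁) - lam • (b y₁ - b y₀)) := by
    simp only [smul_sub, smul_add, smul_neg, inv_smul_smul₀ hlam.ne']
    abel
  rw [e, inner_smul_right] at h1
  have h2 := nonneg_of_mul_nonneg_right h1 (inv_pos.2 hlam)
  simp only [inner_sub_right, inner_add_right, inner_neg_right, inner_smul_right] at h2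
  have h3 : 0 ≤ lam * inner ℝ (y₂ - z) (B y₂ - B z) := mul_nonneg hlam.le (hB _ _ _ rfl _ rfl)
  have e1 : y₂ - z = (y₂ - y₁) + (y₁ - z) := by abel
  have h4 : ‖y₂ - z‖ ^ 2 = ‖y₂ - y₁‖ ^ 2 + 2 * inner ℝ (y₂ - y₁) (y₁ - z) + ‖y₁ - z‖ ^ 2 := by
    rw [e1, norm_add_sq_real]
  have h5 : inner ℝ (y₂ - z) (y₂ - y₁) = ‖y₂ - y₁‖ ^ 2 + inner ℝ (y₂ - y₁) (y₁ - z) := by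
    rw [e1, inner_add_left, real_inner_self_eq_norm_sq, real_inner_comm (y₁ - z)]
  -- The `y₁ - z` part is kept for averaging, since `y₂` depends on the sampled `b`. The `y₂ - y₁`
  -- part is bounded by Young's inequality in `h8`.
  have h6 : inner ℝ (y₂ - z) (b y₁ - b y₀)
      = inner ℝ (b y₁ - b y₀) (y₂ - y₁) + inner ℝ (b y₁ - b y₀) (y₁ - z) := by
    rw [real_inner_comm, e1, inner_add_right]
  have h7 := mul_le_mul_of_nonneg_left (neg_le_of_abs_le (hb.abs_inner_sub_le y₁ y₀ (y₂ - y₁))) hlam.le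
  have hL : 0 ≤ lam * L := by positivity
  have h8 := mul_nonneg hL (sq_nonneg (‖y₁ - y₀‖ - ‖y₂ - y₁‖))
  have h9 : inner ℝ (y₂ - z) (B y₂ - B y₁) = inner ℝ (B y₂ - B y₁) (y₂ - z) := real_inner_comm _ _
  simp only [inner_sub_right] at h3 h5 h6 h9
  simp only [reflectedEnergy, inner_sub_left _ _ (y₁ - z)] at *
  simp only [inner_sub_left, inner_sub_right] at *
  nlinarith

/-- Weak convergence of one path of the iteration, given convergence of the Lyapunov functions. -/
theorem exists_weak_limit_of_reflectedEnergy [CompleteSpace H] {A : H → Set H}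
    (hA : IsMaximallyMonotone A) {B : H → H} (hB : IsMonotoneOperator (toSetValued B)) {L : ℝ≥0}
    (hBL : LipschitzWith L B) {lam : ℝ} (hlam : 0 < lam) (hlamL : 2 * lam * L < 1)
    {b : ℕ → H → H} (hb : ∀ k, LipschitzWith L (b k)) {y : ℕ → H}
    (hy : ∀ k, y (k + 2) = operatorResolvent (lam • A)
      (y (k + 1) - lam • B (y (k + 1)) - lam • (b k (y (k + 1)) - b k (y k))))
    (hzero : (operatorZeros (A + toSetValued B)).Nonempty) {D : Set H}
    (hD : operatorZeros (A + toSetValued B) ⊆ closure D)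
    (hdiff : Tendsto (fun k => ‖y (k + 1) - y k‖) atTop (𝓝 0))
    (henergy : ∀ z ∈ D, ∃ c,
      Tendsto (fun k => reflectedEnergy B lam L z (y k, y (k + 1))) atTop (𝓝 c)) :
    ∃ p ∈ operatorZeros (A + toSetValued B),
      ∀ v, Tendsto (fun k => inner ℝ v (y k)) atTop (𝓝 (inner ℝ v p)) := by
  have hL : 0 ≤ lam * L := by positivity
  have hnormD : ∀ z ∈ D, ∃ c, Tendsto (fun k => ‖y (k + 1) - z‖) atTop (𝓝 c) := by
    intro z hz
    obtain ⟨c, hc⟩ := henergy z hz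
    obtain ⟨C, hC⟩ := hc.bddAbove_range
    -- Since `λL < 1/2`, the squared distance is at most `2C`, and `2t ≤ t² + 1`.
    have hbd : ∀ k, ‖y (k + 1) - z‖ ≤ 2 * C + 1 := by
      intro k
      have h1 := le_reflectedEnergy hBL hlam z (y k, y (k + 1))
      have h2 := hC (Set.mem_range_self k)
      dsimp only at h1 h2
      nlinarith [sq_nonneg (‖y (k + 1) - z‖ - 1), sq_nonneg ‖y (k + 1) - z‖]
    have hcross : Tendsto (fun k => inner ℝ (B (y (k + 1)) - B (y k)) (y (k + 1) - z)) atTop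
        (𝓝 0) := by
      refine squeeze_zero_norm (a := fun k => L * ‖y (k + 1) - y k‖ * (2 * C + 1)) (fun k => ?_) ?_
      · refine (hBL.abs_inner_sub_le _ _ _).trans ?_
        gcongr
        exact hbd k
      · simpa using (hdiff.const_mul (L : ℝ)).mul_const (2 * C + 1)
    have hsq : Tendsto (fun k => ‖y (k + 1) - z‖ ^ 2) atTop (𝓝 c) := by
      have h := (hc.add (hcross.const_mul (2 * lam))).sub ((hdiff.pow 2).const_mul (lam * L))
      simp only [mul_zero, add_zero, ne_eq, OfNat.ofNat_ne_zero, not_false_eq_true, zero_pow,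
        sub_zero] at h
      refine h.congr fun k => ?_
      simp only [reflectedEnergy]
      ring
    exact ⟨√c, by simpa [Real.sqrt_sq] using hsq.sqrt⟩
  have hnorm : ∀ z ∈ operatorZeros (A + toSetValued B), ∃ c,
      Tendsto (fun k => ‖y (k + 2) - z‖) atTop (𝓝 c) := fun z hz => by
    obtain ⟨c, hc⟩ := exists_tendsto_norm_sub_of_mem_closure hnormD (hD hz)
    exact ⟨c, (tendsto_add_atTop_iff_nat 1).2 hc⟩
  obtain ⟨C, hC⟩ : ∃ C, ∀ k, ‖y (k + 2)‖ ≤ C := by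
    obtain ⟨z, hz⟩ := hzero
    obtain ⟨c, hc⟩ := hnorm z hz
    obtain ⟨C, hC⟩ := hc.bddAbove_range
    exact ⟨C + ‖z‖, fun k => by
      linarith [norm_le_norm_sub_add (y (k + 2)) z, hC (Set.mem_range_self k)]⟩
  -- `w k` is the residual in `(A + B)(y (k + 2))` read off from the resolvent step; the common
  -- Lipschitz constant makes it vanish although `b k` varies.
  set w : ℕ → H := fun k => lam⁻¹ • (y (k + 1) - y (k + 2)) + (B (y (k + 2)) - B (y (k + 1)))
    - (b k (y (k + 1)) - b k (y k)) with hw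
  have hmem : ∀ k, w k - B (y (k + 2)) ∈ A (y (k + 2)) := by
    intro k
    have h := hA.inv_smul_sub_resolvent_mem hlam
      (y (k + 1) - lam • B (y (k + 1)) - lam • (b k (y (k + 1)) - b k (y k)))
    rw [← hy k] at h
    convert h using 1
    simp only [hw, smul_sub, inv_smul_smul₀ hlam.ne']
    abel
  have hw0 : Tendsto w atTop (𝓝 0) := by
    have hdiff1 := (tendsto_add_atTop_iff_nat 1).2 hdiff
    refine squeeze_zero_norm (a := fun k => lam⁻¹ * ‖y (k + 1 + 1) - y (k + 1)‖
      + L * ‖y (k + 1 + 1) - y (k + 1)‖ + L * ‖y (k + 1) - y k‖) (fun k => ?_) ?_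
    · refine (norm_sub_le _ _).trans (add_le_add ((norm_add_le _ _).trans (add_le_add ?_ ?_)) ?_)
      · rw [norm_smul, Real.norm_of_nonneg (inv_pos.2 hlam).le, norm_sub_rev]
      · simpa [dist_eq_norm] using hBL.dist_le_mul (y (k + 1 + 1)) (y (k + 1))
      · simpa [dist_eq_norm] using (hb k).dist_le_mul (y (k + 1)) (y k)
    · simpa using ((hdiff1.const_mul lam⁻¹).add (hdiff1.const_mul (L : ℝ))).add
        (hdiff.const_mul (L : ℝ))
  obtain ⟨p, hp, hlim⟩ := exists_weak_limit_of_tendsto_norm_sub hzero hnorm fun U hU p hp =>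
    mem_operatorZeros_of_weak_limit hA hB hBL hC (hw0.mono_left hU) hmem hp
  exact ⟨p, hp, fun v => (tendsto_add_atTop_iff_nat 2).1 (hlim v)⟩

end ForwardReflectedBackward

/-! ### The stochastic iteration and the main theorem. -/

section StochasticIteration

theorem LipschitzWith.average {H : Type*} [NormedAddCommGroup H] [NormedSpace ℝ H] {n : ℕ}
    (hn : 0 < n) {L : ℝ≥0} {Bi : Fin n → H → H} (hLip : ∀ j, LipschitzWith L (Bi j)) :
    LipschitzWith L fun y => (1 / (n : ℝ)) • ∑ j, Bi j y := by
  refine LipschitzWith.of_dist_le_mul fun u v => ?_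
  have hn' : (0 : ℝ) < n := Nat.cast_pos.2 hn
  have h : dist (∑ j, Bi j u) (∑ j, Bi j v) ≤ ∑ _j : Fin n, (L : ℝ) * dist u v :=
    dist_sum_sum_le_of_le _ fun j _ => (hLip j).dist_le_mul u v
  rw [Finset.sum_const, Finset.card_univ, Fintype.card_fin, nsmul_eq_mul] at h
  rw [dist_smul₀, Real.norm_of_nonneg (by positivity), one_div, inv_mul_le_iff₀ hn']
  exact h

/-- The random indices take finitely many values, so each iterate does as well. -/
theorem finite_range_of_recursion {Ω H ι : Type*} [Finite ι] {i : ℕ → Ω → ι}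
    {F : ι → H × H → H} {y : ℕ → Ω → H} (h0 : ∀ ω ω', (y 0 ω, y 1 ω) = (y 0 ω', y 1 ω'))
    (hy : ∀ k ω, y (k + 2) ω = F (i k ω) (y k ω, y (k + 1) ω)) (k : ℕ) :
    (Set.range fun ω => (y k ω, y (k + 1) ω)).Finite := by
  induction k with
  | zero => exact Set.Subsingleton.finite (by rintro _ ⟨ω, rfl⟩ _ ⟨ω', rfl⟩; exact h0 ω ω')
  | succ k ih =>
    refine ((Set.finite_univ (α := ι)).prod ih |>.image fun q => (q.2.2, F q.1 q.2)).subset ?_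
    rintro _ ⟨ω, rfl⟩
    exact ⟨(i k ω, (y k ω, y (k + 1) ω)), ⟨trivial, ω, rfl⟩, by simp [hy]⟩

/-- The iterates are predictable for the filtration of the random indices. -/
theorem measurable_of_recursion {Ω H : Type*} [MeasurableSpace Ω] [MeasurableSpace H] {n : ℕ}
    {i : ℕ → Ω → Fin n} (hi : ∀ k, Measurable (i k)) {F : Fin n → H × H → H}
    (hF : ∀ j, Measurable (F j)) {y : ℕ → Ω → H}
    (h0 : ∀ ω ω', (y 0 ω, y 1 ω) = (y 0 ω', y 1 ω'))
    (hy : ∀ k ω, y (k + 2) ω = F (i k ω) (y k ω, y (k + 1) ω)) (k : ℕ) :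
    Measurable[strictPastFiltration i hi k] fun ω => (y k ω, y (k + 1) ω) := by
  induction k with
  | zero => exact @measurable_const' _ _ _ (strictPastFiltration i hi 0) _ h0
  | succ k ih =>
    have ih' := ih.mono ((strictPastFiltration i hi).mono k.le_succ) le_rfl
    have hik := measurable_strictPastFiltration_succ hi k
    have hF' : Measurable fun q : Fin n × (H × H) => F q.1 q.2 :=
      measurable_from_prod_countable_right hF
    have h2 : Measurable[strictPastFiltration i hi (k + 1)] (y (k + 2)) := by
      have e : y (k + 2) = (fun q : Fin n × (H × H) => F q.1 q.2) ∘
          fun ω => (i k ω, (y k ω, y (k + 1) ω)) := funext fun ω => hy k ω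
      rw [e]
      exact hF'.comp (Measurable.prodMk hik ih')
    exact Measurable.prodMk ih'.snd h2

/-- Since each iterate takes finitely many values, this replaces all moment estimates. -/
theorem integrable_comp_of_finite_range {Ω K : Type*} [MeasurableSpace Ω] [MeasurableSpace K]
    {μ : Measure Ω} [IsFiniteMeasure μ] {f : Ω → K} (hf : Measurable f)
    (hfin : (Set.range f).Finite) {Φ : K → ℝ} (hΦ : Measurable Φ) :
    Integrable (fun ω => Φ (f ω)) μ := by
  obtain ⟨C, hC⟩ := (hfin.image fun q => ‖Φ q‖).bddAbove
  exact Integrable.of_bound (hΦ.comp hf).aestronglyMeasurable C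
    (Eventually.of_forall fun ω => hC ⟨_, ⟨ω, rfl⟩, rfl⟩)

variable {H : Type*} [NormedAddCommGroup H] [InnerProductSpace ℝ H] [CompleteSpace H]
  [TopologicalSpace.SeparableSpace H] [MeasurableSpace H] [BorelSpace H]
  {Ω : Type*} [MeasurableSpace Ω] {μ : Measure Ω} [IsProbabilityMeasure μ]

/-- Almost sure convergence of the Lyapunov function along the stochastic iteration. -/
theorem ae_tendsto_reflectedEnergy
    {A : H → Set H} (hA : IsMaximallyMonotone A)
    {B : H → H} (hB : IsMonotoneOperator (toSetValued B))
    {n : ℕ} (hn : 0 < n) {Bi : Fin n → H → H}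
    (hBsum : ∀ y, B y = (1 / (n : ℝ)) • ∑ j, Bi j y)
    {L : ℝ≥0} (hLip : ∀ j, LipschitzWith L (Bi j))
    {lam : ℝ} (hlam : 0 < lam) (hlamL : 2 * lam * L < 1)
    {i : ℕ → Ω → Fin n} (hi : ∀ k, Measurable (i k)) (hindep : iIndepFun i μ)
    (hunif : ∀ k j, μ {ω | i k ω = j} = (n : ℝ≥0∞)⁻¹)
    {y : ℕ → Ω → H} (hmeas : ∀ k, Measurable[strictPastFiltration i hi k] fun ω => (y k ω, y (k + 1) ω))
    (hfin : ∀ k, (Set.range fun ω => (y k ω, y (k + 1) ω)).Finite)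
    (hy : ∀ k ω, y (k + 2) ω = operatorResolvent (lam • A) (y (k + 1) ω - lam • B (y (k + 1) ω)
      - lam • (Bi (i k ω) (y (k + 1) ω) - Bi (i k ω) (y k ω))))
    {z : H} (hz : z ∈ operatorZeros (A + toSetValued B)) :
    ∀ᵐ ω ∂μ,
      (∃ c, Tendsto (fun k => reflectedEnergy B lam L z (y k ω, y (k + 1) ω)) atTop (𝓝 c)) ∧
        Tendsto (fun k => ‖y (k + 1) ω - y k ω‖) atTop (𝓝 0) := by
  have : SecondCountableTopology H := UniformSpace.secondCountable_of_separable H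
  have hBL : LipschitzWith L B := by
    rw [show B = _ from funext hBsum]
    exact LipschitzWith.average hn hLip
  set ℱ := strictPastFiltration i hi
  set c := 1 - 2 * lam * L with hc
  have hc0 : 0 < c := by linarith
  have hint : ∀ k {Φ : H × H → ℝ}, Continuous Φ →
      Integrable (fun ω => Φ (y k ω, y (k + 1) ω)) μ := fun k Φ hΦ =>
    integrable_comp_of_finite_range ((hmeas k).mono (ℱ.le k) le_rfl) (hfin k) hΦ.measurable
  have hsm : ∀ k {Φ : H × H → ℝ}, Continuous Φ →
      StronglyMeasurable[ℱ k] fun ω => Φ (y k ω, y (k + 1) ω) := fun k Φ hΦ =>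
    (hΦ.measurable.comp (hmeas k)).stronglyMeasurable
  have hE := continuous_reflectedEnergy hBL.continuous lam L z
  have hBc := hBL.continuous
  have hBic := fun j => (hLip j).continuous
  have hdist : Continuous fun p : H × H => c * ‖p.2 - p.1‖ ^ 2 := by fun_prop
  -- The error term of the one-step estimate when index `j` is drawn; it sums to zero over `j`
  -- because `∑ Bi = n B`.
  set G : Fin n → H × H → ℝ := fun j p =>
    2 * lam * inner ℝ ((B p.2 - B p.1) - (Bi j p.2 - Bi j p.1)) (p.2 - z) with hG
  have hGc : ∀ j, Continuous (G j) := fun j => by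
    have := hBic j
    simp only [hG]
    fun_prop
  have hGsum : ∀ p, ∑ j, G j p = 0 := by
    intro p
    have hn' : (n : ℝ) ≠ 0 := Nat.cast_ne_zero.2 hn.ne'
    have e : ∀ q, ∑ j, Bi j q = (n : ℝ) • B q := fun q => by
      rw [hBsum, one_div, smul_inv_smul₀ hn']
    simp only [hG, ← Finset.mul_sum, ← sum_inner, Finset.sum_sub_distrib, e, Finset.sum_const,
      Finset.card_univ, Fintype.card_fin, ← Nat.cast_smul_eq_nsmul ℝ, sub_self,
      inner_zero_left, mul_zero]
  have hmain := ae_tendsto_of_setIntegral_add_le (μ := μ) (ℱ := ℱ)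
    (V := fun k ω => reflectedEnergy B lam L z (y k ω, y (k + 1) ω))
    -- This increment involves the index `i k`, so it is measurable only at time `k + 1`.
    (D := fun k ω => c * ‖y (k + 1 + 1) ω - y (k + 1) ω‖ ^ 2)
    (fun k => hsm k hE) (fun k => hsm (k + 1) hdist) (fun k => hint k hE)
    (fun k => hint (k + 1) hdist) (fun k ω => reflectedEnergy_nonneg hBL hlam hlamL z _)
    (fun k ω => by positivity) fun k s hs => by
      have hGi : Integrable (fun ω => G (i k ω) (y k ω, y (k + 1) ω)) μ := by
        refine integrable_comp_of_finite_range (K := Fin n × (H × H))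
          (f := fun ω => (i k ω, (y k ω, y (k + 1) ω))) (Φ := fun q => G q.1 q.2)
          ((hi k).prodMk ((hmeas k).mono (ℱ.le k) le_rfl))
          ((Set.finite_univ.prod (hfin k)).subset ?_)
          (measurable_from_prod_countable_right fun j => (hGc j).measurable)
        rintro _ ⟨ω, rfl⟩
        exact ⟨trivial, ω, rfl⟩
      have hzero : ∫ ω in s, G (i k ω) (y k ω, y (k + 1) ω) ∂μ = 0 := by
        rw [setIntegral_apply_uniform (ℱ.le k) (hi k) (indep_strictPastFiltration hi hindep k)
          (hunif k) (G := fun j ω => G j (y k ω, y (k + 1) ω)) (fun j => hsm k (hGc j))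
          (fun j => hint k (hGc j)) hs]
        simp [hGsum]
      calc _ ≤ ∫ ω in s, (reflectedEnergy B lam L z (y k ω, y (k + 1) ω)
            + G (i k ω) (y k ω, y (k + 1) ω)) ∂μ :=
            integral_mono ((hint (k + 1) hE).add (hint (k + 1) hdist)).integrableOn
              ((hint k hE).add hGi).integrableOn fun ω =>
                reflectedEnergy_step hA hB hlam (hLip (i k ω)) hz (hy k ω)
        _ = _ := by
            rw [integral_add (hint k hE).integrableOn hGi.integrableOn, hzero, add_zero]
  filter_upwards [hmain] with ω hω
  refine ⟨hω.1, (tendsto_add_atTop_iff_nat 1).1 ?_⟩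
  have h := (hω.2.const_mul c⁻¹).sqrt
  simpa [← mul_assoc, inv_mul_cancel₀ hc0.ne', Real.sqrt_sq] using h

/-- Almost sure weak convergence of the stochastic iteration, indexed from `0`. -/
theorem ae_exists_weak_limit
    {A : H → Set H} (hA : IsMaximallyMonotone A)
    {B : H → H} (hB : IsMonotoneOperator (toSetValued B))
    {n : ℕ} (hn : 0 < n) {Bi : Fin n → H → H}
    (hBsum : ∀ y, B y = (1 / (n : ℝ)) • ∑ j, Bi j y)
    {L : ℝ≥0} (hLip : ∀ j, LipschitzWith L (Bi j))
    (hzero : (operatorZeros (A + toSetValued B)).Nonempty)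
    {lam : ℝ} (hlam : 0 < lam) (hlamL : 2 * lam * L < 1)
    {i : ℕ → Ω → Fin n} (hi : ∀ k, Measurable (i k)) (hindep : iIndepFun i μ)
    (hunif : ∀ k j, μ {ω | i k ω = j} = (n : ℝ≥0∞)⁻¹)
    {y : ℕ → Ω → H} (hy0 : ∀ ω ω', (y 0 ω, y 1 ω) = (y 0 ω', y 1 ω'))
    (hy : ∀ k ω, y (k + 2) ω = operatorResolvent (lam • A) (y (k + 1) ω - lam • B (y (k + 1) ω)
      - lam • (Bi (i k ω) (y (k + 1) ω) - Bi (i k ω) (y k ω)))) :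
    (∀ k, Measurable (y k)) ∧ ∀ᵐ ω ∂μ, ∃ p ∈ operatorZeros (A + toSetValued B),
      ∀ v, Tendsto (fun k => inner ℝ v (y k ω)) atTop (𝓝 (inner ℝ v p)) := by
  have : SecondCountableTopology H := UniformSpace.secondCountable_of_separable H
  have hBL : LipschitzWith L B := by
    rw [show B = _ from funext hBsum]
    exact LipschitzWith.average hn hLip
  let F : Fin n → H × H → H := fun j p =>
    operatorResolvent (lam • A) (p.2 - lam • B p.2 - lam • (Bi j p.2 - Bi j p.1))
  have hF : ∀ j, Measurable (F j) := fun j => by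
    have h1 := hBL.continuous
    have h2 := (hLip j).continuous
    refine Continuous.measurable ((hA.lipschitzWith_resolvent hlam).continuous.comp ?_)
    fun_prop
  have hfin := finite_range_of_recursion (F := F) hy0 hy
  have hmeas := measurable_of_recursion hi hF hy0 hy
  refine ⟨fun k => ((hmeas k).mono ((strictPastFiltration i hi).le k) le_rfl).fst, ?_⟩
  -- Countability of `D` gives one null set for all `z ∈ D`; density extends the conclusion to all
  -- zeros.
  obtain ⟨D, hDsub, hDc, hDdense⟩ := (TopologicalSpace.IsSeparable.of_separableSpace
    (operatorZeros (A + toSetValued B))).exists_countable_dense_subset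
  have hall : ∀ {z}, z ∈ operatorZeros (A + toSetValued B) → _ := fun hz =>
    ae_tendsto_reflectedEnergy hA hB hn hBsum hLip hlam hlamL hi hindep hunif hmeas hfin hy hz
  filter_upwards [(ae_ball_iff hDc).2 fun z hz => hall (hDsub hz), hall hzero.some_mem]
    with ω hω hω'
  exact exists_weak_limit_of_reflectedEnergy hA hB hBL hlam hlamL (fun k => hLip (i k ω))
    (fun k => hy k ω) hzero hDdense hω'.2 fun z hz => (hω z hz).1

end StochasticIteration

theorem mainTheorem6
    {H : Type*} [NormedAddCommGroup H] [InnerProductSpace ℝ H] [CompleteSpace H]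
    [TopologicalSpace.SeparableSpace H] [MeasurableSpace H] [BorelSpace H]
    {Ω : Type*} [MeasurableSpace Ω] (μ : Measure Ω) [IsProbabilityMeasure μ]
    -- the operators
    (A : H → Set H) (hA : IsMaximallyMonotone A)
    (B : H → H) (hB : IsMonotoneOperator (toSetValued B))
    (n : ℕ) (hn : 0 < n) (Bi : Fin n → H → H)
    (hBsum : ∀ y, B y = (1 / (n : ℝ)) • ∑ j, Bi j y)
    (L : ℝ≥0) (hLip : ∀ j, LipschitzWith L (Bi j))
    (hzero : (operatorZeros (A + toSetValued B)).Nonempty)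
    -- `lam ∈ (0, 1 / (2 L))`, the interval being `(0, ∞)` when `L = 0`
    (lam : ℝ) (hlam_pos : 0 < lam) (hlam_lt : 2 * lam * L < 1)
    -- the indices are independent and uniform on `{1, …, n}`
    (i : ℕ → Ω → Fin n) (hmeas : ∀ k, Measurable (i k)) (hindep : iIndepFun i μ)
    (hunif : ∀ k j, μ {ω | i k ω = j} = (n : ℝ≥0∞)⁻¹)
    -- the iterates `x (-1), x 0, x 1, …` (values at indices below `-1` play no role)
    (xm1 x0 : H) (x : ℤ → Ω → H)
    (hxm1 : ∀ ω, x (-1) ω = xm1) (hx0 : ∀ ω, x 0 ω = x0)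
    (hstep : ∀ (k : ℕ) (ω : Ω), x (k + 1) ω =
      operatorResolvent (lam • A)
        (x k ω - lam • B (x k ω) - lam • (Bi (i k ω) (x k ω) - Bi (i k ω) (x (k - 1) ω)))) :
    ∃ xlim : Ω → H, Measurable xlim ∧
      ∀ᵐ ω ∂μ, xlim ω ∈ operatorZeros (A + toSetValued B) ∧
        Tendsto (fun k : ℕ => toWeakSpace ℝ H (x k ω)) atTop (𝓝 (toWeakSpace ℝ H (xlim ω))) := by
  -- The shift `y k = x (k - 1)` starts the two-term recursion at `0`.
  obtain ⟨hmeasY, hae⟩ := ae_exists_weak_limit (y := fun k => x ((k : ℤ) - 1)) hA hB hn hBsum hLip hzero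
    hlam_pos hlam_lt hmeas hindep hunif (fun ω ω' => by simp [hxm1, hx0]) (fun k ω => by
      have h := hstep k ω
      have e1 : ((k + 2 : ℕ) : ℤ) - 1 = k + 1 := by push_cast; ring
      have e2 : ((k + 1 : ℕ) : ℤ) - 1 = k := by push_cast; ring
      simp only [e1, e2]
      exact h)
  -- The bad set need not be measurable. Setting iterates and limit to `0` on a measurable null
  -- superset gives weak convergence everywhere, hence a measurable limit.
  obtain ⟨t, hts, htm, ht⟩ := exists_measurable_superset_of_null (ae_iff.1 hae)
  have hgood : ∀ ω ∉ t, ∃ p ∈ operatorZeros (A + toSetValued B),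
      ∀ v, Tendsto (fun k : ℕ => inner ℝ v (x ((k : ℤ) - 1) ω)) atTop (𝓝 (inner ℝ v p)) :=
    fun ω hω => by_contra fun h => hω (hts h)
  choose! p hpZ hp using hgood
  refine ⟨tᶜ.indicator p, ?_, ?_⟩
  · refine measurable_of_tendsto_inner (f := fun k => tᶜ.indicator (x ((k : ℤ) - 1)))
      (fun k => (hmeasY k).indicator htm.compl) fun ω v => ?_
    by_cases hω : ω ∈ t
    · simp [hω]
    · simpa [hω] using hp ω hω v
  · filter_upwards [measure_eq_zero_iff_ae_notMem.1 ht] with ω hω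
    rw [Set.indicator_of_mem hω]
    refine ⟨hpZ ω hω, tendsto_toWeakSpace_iff_inner.2 fun v => ?_⟩
    simpa using (tendsto_add_atTop_iff_nat 1).2 (hp ω hω v)
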